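/- **Definitions.** Let $H$ be a cancellative commutative monoid with group of units $H^\times$ and quotient group $\mathsf q(H)$. Its complete integral closure is $$\widehat H=\{x\in\mathsf q(H)\mid \text{there is } c\in H \text{ such that } cx^n\in H \text{ for all } n\ge 1\}.$$ The monoid $H$ is *finitely primary* of rank $s\ge 1$ and exponent $\alpha\ge 1$ if $\widehat H$ is factorial with exactly $s$ prime elements up to associates and, for a system $p_1,\dots,p_s$ of representatives of these primes, $$H\setminus H^\times\subset p_1\cdots p_s\,\widehat H\qquad\text{and}\qquad (p_1\cdots p_s)^\alpha\,\widehat H\subset H .$$ Let $\mathsf v_{p_i}$ denote the $p_i$-adic exponent on $\widehat H$. Let $H$ be a finitely primary monoid of rank $s$ for which there are an exponent $\alpha\ge 1$ of $H$ and a system $p_1,\dots,p_s$ of representatives of the primes of $\widehat H$ such that for all $i\in\{1,\dots,s\}$ and all $a\in\widehat H$ with $\mathsf v_{p_i}(a)\ge\alpha$ we have $p_ia\in H$ if and only if $a\in H$. Consider the two conditions (a) the group $\widehat H^\times/H^\times$ is finite; (b) the set $\{(\mathsf v_{p_1}(a),\dots,\mathsf v_{p_s}(a))\mid a\in H\setminus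 H^\times\}\subset\mathbb N^s$ has a smallest element with respect to the componentwise order. Then $H$ is called *ring-like* if (a) or (b) holds, and *strongly ring-like* if both (a) and (b) hold. For a domain $R$ with quotient field $K$, let $R^\bullet=R\setminus\{0\}$ be its multiplicative monoid of nonzero elements, let $\widehat R=\widehat{R^\bullet}\cup\{0\}\subset K$ be its complete integral closure, and let $(R:\widehat R)=\{x\in K\mid x\widehat R\subset R\}$ be its conductor. Let $\max(\widehat R)$ be the set of maximal ideals of $\widehat R$. "Local" means having exactly one maximal ideal, and "semilocal" means having only finitely many maximal ideals; neither includes Noetherian. **Corollary 5.7.** Let $(R,\mathfrak m)$ be a one-dimensional local domain with $(R:\widehat R)\ne\{0\}$. 1. If $\widehat R$ is a semilocal principal ideal domain and $|\max(\widehat R)|\le|R/\mathfrak m|$, then $R^\bullet$ is ring-like. 2. If $R$ is Noetherian, then $R^\bullet$ is ring-like. 3. If $R$ is Noetherian and $|\max(\widehat R)|\le|R/\mathfrak m|<\infty$, then $R^\bullet$ is strongly ring-like. -/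

import Mathlib

/-! Throughout, a cancellative commutative monoid `H` is realised as a submonoid of a commutative
group `G` (for instance its quotient group). -/

universe u v

namespace RingLike

section Monoids

variable {G : Type*} [CommGroup G]

/-- The group `H^×` of invertible elements of the monoid `H ⊆ G`, as a subgroup of `G`. -/
def unitGroup (H : Submonoid G) : Subgroup G where
  carrier := {x | x ∈ H ∧ x⁻¹ ∈ H}
  one_mem' := ⟨H.one_mem, by simp [H.one_mem]⟩
  mul_mem' := by
    rintro a b ⟨ha, ha'⟩ ⟨hb, hb'⟩
    exact ⟨H.mul_mem ha hb, by rw [mul_inv]; exact H.mul_mem ha' hb'⟩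
  inv_mem' := by
    rintro a ⟨ha, ha'⟩
    exact ⟨ha', by rwa [inv_inv]⟩

/-- The complete integral closure `Ĥ` of `H`: all `x` for which some `c ∈ H` satisfies
`c * x ^ n ∈ H` for every `n`. The case `n = 0` only repeats `c ∈ H`, and the case `n = 1` shows
that `x` lies in the quotient group of `H`, so the ambient group `G` does not matter. -/
def monoidCompleteIntegralClosure (H : Submonoid G) : Submonoid G where
  carrier := {x | ∃ c ∈ H, ∀ n : ℕ, c * x ^ n ∈ H}
  one_mem' := ⟨1, H.one_mem, fun n => by simp [H.one_mem]⟩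
  mul_mem' := by
    rintro a b ⟨c, hc, ha⟩ ⟨d, hd, hb⟩
    refine ⟨c * d, H.mul_mem hc hd, fun n => ?_⟩
    have h : c * d * (a * b) ^ n = (c * a ^ n) * (d * b ^ n) := by
      rw [mul_pow, mul_mul_mul_comm]
    rw [h]
    exact H.mul_mem (ha n) (hb n)

/-- `a = u * ∏ i, p i ^ k i` for some `u ∈ F^×`. If `F` is factorial and the `p i` represent its
prime elements, this says that `k i = v_{p i}(a)` for all `i`. -/
def HasValues (F : Submonoid G) {s : ℕ} (p : Fin s → G) (a : G) (k : Fin s → ℕ) : Prop :=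
  ∃ u ∈ unitGroup F, a = u * ∏ i, p i ^ k i

/-- `F` is the direct product of `F^×` and the free abelian monoid with basis `p 0, …, p (s - 1)`;
in other words, `F` is factorial and the `p i` form a system of representatives of its prime
elements (up to units). -/
structure IsFactorialWith (F : Submonoid G) {s : ℕ} (p : Fin s → G) : Prop where
  mem : ∀ i, p i ∈ F
  existsUnique_values : ∀ a ∈ F, ∃! k : Fin s → ℕ, HasValues F p a k

/-- `H ⊆ F` is finitely primary of rank `s` and exponent `α`, where `F` is factorial with
representatives of primes `p`: every non-unit of `H` lies in `p 0 ⋯ p (s - 1) F`, and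
`(p 0 ⋯ p (s - 1)) ^ α F ⊆ H`. -/
structure IsFinitelyPrimaryIn (H F : Submonoid G) {s : ℕ} (p : Fin s → G) (α : ℕ) : Prop where
  rank_pos : 1 ≤ s
  exponent_pos : 1 ≤ α
  factorial : IsFactorialWith F p
  le : H ≤ F
  nonunit : ∀ a ∈ H, a ∉ unitGroup H → ∃ b ∈ F, a = (∏ i, p i) * b
  conductor : ∀ b ∈ F, (∏ i, p i) ^ α * b ∈ H

/-- For all `i` and all `a ∈ F` with `v_{p i}(a) ≥ α`: `p i * a ∈ H` if and only if `a ∈ H`. -/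
def IsSuitablyChosen (H F : Submonoid G) {s : ℕ} (p : Fin s → G) (α : ℕ) : Prop :=
  ∀ (i : Fin s), ∀ a ∈ F, ∀ k : Fin s → ℕ, HasValues F p a k → α ≤ k i →
    (p i * a ∈ H ↔ a ∈ H)

/-- The set of value vectors `(v_{p i}(a))_i` of the non-units `a` of `H`. -/
def nonunitValues (H F : Submonoid G) {s : ℕ} (p : Fin s → G) : Set (Fin s → ℕ) :=
  {k | ∃ a ∈ H, a ∉ unitGroup H ∧ HasValues F p a k}

/-- The group `Ĥ^× / H^×` is finite. -/
def FiniteUnitIndex (H : Submonoid G) : Prop :=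
  Finite (unitGroup (monoidCompleteIntegralClosure H) ⧸
    (unitGroup H).subgroupOf (unitGroup (monoidCompleteIntegralClosure H)))

/-- `H` is ring-like: it is finitely primary with a suitable choice of exponent and primes, and
`Ĥ^× / H^×` is finite or the value vectors of the non-units have a smallest element. Here we take
`F = Ĥ` because `IsFinitelyPrimaryIn H F p α` forces `F = Ĥ`. -/
def IsRingLike (H : Submonoid G) : Prop :=
  ∃ (s α : ℕ) (p : Fin s → G),
    IsFinitelyPrimaryIn H (monoidCompleteIntegralClosure H) p α ∧
    IsSuitablyChosen H (monoidCompleteIntegralClosure H) p α ∧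
    (FiniteUnitIndex H ∨ ∃ μ, IsLeast (nonunitValues H (monoidCompleteIntegralClosure H) p) μ)

/-- `H` is strongly ring-like: as before, with both of the last two conditions. -/
def IsStronglyRingLike (H : Submonoid G) : Prop :=
  ∃ (s α : ℕ) (p : Fin s → G),
    IsFinitelyPrimaryIn H (monoidCompleteIntegralClosure H) p α ∧
    IsSuitablyChosen H (monoidCompleteIntegralClosure H) p α ∧
    FiniteUnitIndex H ∧ ∃ μ, IsLeast (nonunitValues H (monoidCompleteIntegralClosure H) p) μ

end Monoids

section Domains

variable (R K : Type*) [CommRing R] [Field K] [Algebra R K]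

/-- The multiplicative monoid `R^• = R \ {0}` of a domain `R`, as a submonoid of the
multiplicative group of its quotient field `K`. -/
def nonzeroMonoid : Submonoid Kˣ where
  carrier := {x | ∃ a : R, algebraMap R K a = x}
  one_mem' := ⟨1, by simp⟩
  mul_mem' := by
    rintro x y ⟨a, ha⟩ ⟨b, hb⟩
    exact ⟨a * b, by rw [map_mul, ha, hb, Units.val_mul]⟩

/-- The conductor `(R : R̂) = {x ∈ K | x R̂ ⊆ R}`, where `R̂` is the complete integral closure
of `R` in `K`. -/
def conductor : Submodule R K :=
  (1 : Submodule R K) / Subalgebra.toSubmodule (completeIntegralClosure R K)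

end Domains

end RingLike

/-!
Write `R̂` for the complete integral closure of `R`, `k` for the residue field, and let `c ≠ 0` be
an element of `R` with `c R̂ ⊆ R`; such an element exists because the conductor is not zero
(`exists_forall_dvd_mem_range`).

Suppose that `R̂` is a principal ideal domain with finitely many maximal ideals, with generators
`p 0, …, p (s - 1)`. The contraction of `(p i)` to `R` is prime and contains a nonzero multiple of
`c`, so it is the maximal ideal (`dvd_algebraMap_iff_mem_maximalIdeal`). Hence every non-unit of
`R` is divisible by all `p i`, and `c` divides `(∏ p i) ^ α` for large `α`: the monoid `R^•` is
finitely primary. After multiplying the `p i` by units we have `p i ≡ 1` modulo `p j ^ α` for all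
`j ≠ i`. If `p i ^ α` divides `a`, then `c` divides `(p i - 1) a`, so `p i a` and `a` differ by an
element of `R` (`IsPrimeSystem.exists_adapted`).

For non-units `a, b` of `R`, each `p i` has too large a value on at most one of the combinations
`x a + y b`, where `(x : y)` runs through the projective line over `k`. That line has more than `s`
points if `s ≤ |k|`, so some combination has the minimum of the value vectors of `a` and `b`
(`IsPrimeSystem.exists_linearCombination_inf`). A nonempty set of value vectors closed under minima
has a least element.

If `R` is Noetherian, multiplication by `c` embeds `R̂` into `R`, so `R̂` is a finite `R`-module
and a semilocal Dedekind domain, hence a principal ideal domain. If moreover `k` is finite, then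
`R̂ / c R̂` is finite, and units of `R̂` that are congruent modulo `c` differ by a unit of `R`
(`finiteUnitIndex_nonzeroMonoid`). If `k` is infinite, then `|max R̂| ≤ |k|` holds automatically,
so at least one of the two conditions on a ring-like monoid is satisfied.
-/

namespace RingLike

/-! ### Systems of representatives of primes -/

section PrimeSystems

open Finset

/-- The family `p` represents the prime elements of `D`: each `p i` is prime, and every prime
element is divisible by `p i` for exactly one `i`. -/
structure IsPrimeSystem {D : Type*} [CommRing D] {s : ℕ} (p : Fin s → D) : Prop where
  prime : ∀ i, Prime (p i)
  eq_of_dvd : ∀ i j, p i ∣ p j → i = j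
  exists_dvd : ∀ q, Prime q → ∃ i, p i ∣ q

namespace IsPrimeSystem

variable {D : Type*} [CommRing D] {s : ℕ} {p : Fin s → D}

theorem of_associated (hp : IsPrimeSystem p) {q : Fin s → D} (h : ∀ i, Associated (p i) (q i)) :
    IsPrimeSystem q where
  prime i := (h i).prime (hp.prime i)
  eq_of_dvd i j hij := hp.eq_of_dvd i j (((h i).dvd_iff_dvd_left.2 hij).trans (h j).symm.dvd)
  exists_dvd r hr := (hp.exists_dvd r hr).imp fun i hi => (h i).dvd_iff_dvd_left.1 hi

variable [IsDomain D]

theorem pow_dvd_iff (hp : IsPrimeSystem p) (u : Dˣ) (k : Fin s → ℕ) (i : Fin s) (n : ℕ) :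
    p i ^ n ∣ u * ∏ j, p j ^ k j ↔ n ≤ k i := by
  rw [Units.dvd_mul_left]
  constructor
  · intro h
    by_contra! hlt
    rw [← mul_prod_erase univ _ (mem_univ i)] at h
    have h1 : p i ^ k i * p i ∣ p i ^ k i * ∏ j ∈ univ.erase i, p j ^ k j := by
      rw [← pow_succ]
      exact (pow_dvd_pow _ hlt).trans h
    have h2 := (mul_dvd_mul_iff_left (pow_ne_zero _ (hp.prime i).ne_zero)).1 h1
    obtain ⟨j, hj, hd⟩ := (hp.prime i).exists_mem_finset_dvd h2
    exact (ne_of_mem_erase hj) (hp.eq_of_dvd i j ((hp.prime i).dvd_of_dvd_pow hd)).symm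
  · intro h
    exact (pow_dvd_pow _ h).trans (dvd_prod_of_mem (fun j => p j ^ k j) (mem_univ i))

theorem values_unique (hp : IsPrimeSystem p) {u u' : Dˣ} {k k' : Fin s → ℕ}
    (h : (u : D) * ∏ j, p j ^ k j = u' * ∏ j, p j ^ k' j) : k = k' := by
  funext i
  apply le_antisymm
  · rw [← hp.pow_dvd_iff u', ← h, hp.pow_dvd_iff]
  · rw [← hp.pow_dvd_iff u, h, hp.pow_dvd_iff]

variable [IsPrincipalIdealRing D]

theorem isUnit_of_forall_not_dvd (hp : IsPrimeSystem p) {a : D} (ha : a ≠ 0)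
    (h : ∀ i, ¬ p i ∣ a) : IsUnit a := by
  by_contra hu
  obtain ⟨q, hq, hqa⟩ := WfDvdMonoid.exists_irreducible_factor hu ha
  obtain ⟨i, hi⟩ := hp.exists_dvd q hq.prime
  exact h i (hi.trans hqa)

theorem exists_values (hp : IsPrimeSystem p) {a : D} (ha : a ≠ 0) :
    ∃ (u : Dˣ) (k : Fin s → ℕ), a = u * ∏ i, p i ^ k i := by
  induction a using UniqueFactorizationMonoid.induction_on_prime with
  | h₁ => exact absurd rfl ha
  | h₂ x hx => exact ⟨hx.unit, 0, by simp⟩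
  | h₃ a q ha0 hq ih =>
    obtain ⟨u, k, rfl⟩ := ih ha0
    obtain ⟨i, hi⟩ := hp.exists_dvd q hq
    obtain ⟨w, rfl⟩ := (hp.prime i).associated_of_dvd hq hi
    refine ⟨u * w, k + Pi.single i 1, ?_⟩
    have h1 : ∏ j, p j ^ (Pi.single i 1 : Fin s → ℕ) j = p i := by
      simp [Pi.single_apply, pow_ite]
    simp only [Pi.add_apply, pow_add, prod_mul_distrib, h1, Units.val_mul]
    ring

/-- An element whose `p i`-adic value is exactly `k i` for every `i` has the value vector `k`. -/
theorem exists_eq_of_pow_dvd (hp : IsPrimeSystem p) {a : D} (ha : a ≠ 0) {k : Fin s → ℕ}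
    (h : ∀ i, p i ^ k i ∣ a) (h' : ∀ i, ¬ p i ^ (k i + 1) ∣ a) :
    ∃ u : Dˣ, a = u * ∏ i, p i ^ k i := by
  obtain ⟨u, l, rfl⟩ := hp.exists_values ha
  simp only [hp.pow_dvd_iff] at h h'
  obtain rfl : l = k := funext fun i => le_antisymm (by have := h' i; lia) (h i)
  exact ⟨u, rfl⟩

theorem prod_dvd (hp : IsPrimeSystem p) {a : D} (h : ∀ i, p i ∣ a) : ∏ i, p i ∣ a := by
  rcases eq_or_ne a 0 with rfl | ha
  · exact dvd_zero _
  obtain ⟨u, k, rfl⟩ := hp.exists_values ha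
  refine dvd_mul_of_dvd_right (prod_dvd_prod_of_dvd _ _ fun i _ => dvd_pow_self _ ?_) _
  have := (hp.pow_dvd_iff u k i 1).1 (by simpa using h i)
  lia

theorem exists_dvd_prod_pow (hp : IsPrimeSystem p) {c : D} (hc : c ≠ 0) :
    ∃ α, 1 ≤ α ∧ c ∣ (∏ i, p i) ^ α := by
  obtain ⟨u, k, rfl⟩ := hp.exists_values hc
  refine ⟨∑ i, k i + 1, by lia, ?_⟩
  rw [Units.mul_left_dvd, ← prod_pow]
  refine prod_dvd_prod_of_dvd _ _ fun i _ => pow_dvd_pow _ ?_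
  have := single_le_sum (f := k) (fun j _ => Nat.zero_le _) (mem_univ i)
  lia

/-- Each `p i` has an associate that is congruent to `1` modulo the `α`-th powers of all the
other primes. -/
theorem exists_unit_mul_sub_one_dvd (hp : IsPrimeSystem p) {α : ℕ} (hα : 1 ≤ α) (i : Fin s) :
    ∃ w : Dˣ, ∏ j ∈ univ.erase i, p j ^ α ∣ p i * w - 1 := by
  have hcop : IsCoprime (p i ^ 2) (∏ j ∈ univ.erase i, p j ^ α) := by
    refine IsCoprime.pow_left (IsCoprime.prod_right fun j hj => IsCoprime.pow_right ?_)
    rw [(hp.prime i).irreducible.coprime_iff_not_dvd]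
    exact fun h => ne_of_mem_erase hj (hp.eq_of_dvd i j h).symm
  obtain ⟨x, y, hxy⟩ := hcop
  set Q := ∏ j ∈ univ.erase i, p j ^ α with hQ
  -- With `x * p i ^ 2 + y * Q = 1`, the element `w` is `1` modulo `p i` and an inverse of `p i`
  -- modulo `Q`.
  set w := y * Q + x * p i with hw
  have hd : Q ∣ p i * w - 1 := ⟨p i * y - y, by rw [hw]; linear_combination hxy⟩
  have hnd : ∀ j, ¬ p j ∣ w := by
    intro j hj
    apply (hp.prime j).not_isUnit
    rw [isUnit_iff_dvd_one]
    rcases eq_or_ne j i with rfl | hji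
    · have h1 : (1 : D) = w + p j * (x * p j - x) := by rw [hw]; linear_combination -hxy
      rw [h1]
      exact dvd_add hj (dvd_mul_right _ _)
    · have h1 : p j ∣ Q :=
        (dvd_pow_self _ (by lia)).trans (dvd_prod_of_mem _ (mem_erase.2 ⟨hji, mem_univ j⟩))
      have h2 := dvd_sub (dvd_mul_of_dvd_right hj (p i)) (h1.trans hd)
      simpa using h2
  have hw0 : w ≠ 0 := fun h0 => hnd i (h0 ▸ dvd_zero _)
  obtain ⟨w', hw'⟩ := hp.isUnit_of_forall_not_dvd hw0 hnd
  exact ⟨w', hw' ▸ hd⟩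

/-- For `c ≠ 0` the primes and the exponent `α` can be chosen such that `c` divides
`(∏ i, p i) ^ α`, and divides `(p i - 1) * a` whenever `p i ^ α` divides `a`. -/
theorem exists_adapted (hp : IsPrimeSystem p) {c : D} (hc : c ≠ 0) :
    ∃ (q : Fin s → D) (α : ℕ), IsPrimeSystem q ∧ 1 ≤ α ∧ c ∣ (∏ i, q i) ^ α ∧
      ∀ i a, q i ^ α ∣ a → c ∣ (q i - 1) * a := by
  obtain ⟨α, hα, hcα⟩ := hp.exists_dvd_prod_pow hc
  choose w hw using hp.exists_unit_mul_sub_one_dvd hα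
  have hass : ∀ i, Associated (p i) (p i * w i) := fun i => ⟨w i, rfl⟩
  refine ⟨fun i => p i * w i, α, hp.of_associated hass, hα, ?_, ?_⟩
  · rw [prod_mul_distrib]
    exact hcα.trans (pow_dvd_pow_of_dvd (dvd_mul_right _ _) _)
  · intro i a ha
    rw [← prod_pow, ← mul_prod_erase univ _ (mem_univ i), mul_comm] at hcα
    exact hcα.trans (mul_dvd_mul (hw i) ((pow_dvd_pow_of_dvd (hass i).dvd _).trans ha))

/-- A value vector that is the minimum of those of `a` and `b` is attained by an `R`-linear
combination of `a` and `b`, provided the projective line over the residue field of `R` has more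
than `s` points. -/
theorem exists_linearCombination_inf (hp : IsPrimeSystem p) {R : Type*} [CommRing R]
    [IsLocalRing R] [Algebra R D] (hs : 1 ≤ s)
    (hR : ∀ i (r : R), p i ∣ algebraMap R D r → r ∈ IsLocalRing.maximalIdeal R)
    (hcard : ∀ f : Option (IsLocalRing.ResidueField R) → Fin s, ¬ Function.Injective f)
    {u u' : Dˣ} {k l : Fin s → ℕ} {a b : D} (ha : a = u * ∏ i, p i ^ k i)
    (hb : b = u' * ∏ i, p i ^ l i) :
    ∃ (x y : R) (w : Dˣ), algebraMap R D x * a + algebraMap R D y * b =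
      w * ∏ i, p i ^ (k ⊓ l) i := by
  -- `c o` runs through the points `b` and `a + r * b` of the projective line; `i` spoils `c o` if
  -- the `p i`-adic value of `c o` is too large.
  choose g hg using (IsLocalRing.residue_surjective : Function.Surjective (IsLocalRing.residue R))
  let x : Option (IsLocalRing.ResidueField R) → R := fun o => o.elim 0 fun _ => 1
  let y : Option (IsLocalRing.ResidueField R) → R := fun o => o.elim 1 g
  let c : Option (IsLocalRing.ResidueField R) → D := fun o =>
    algebraMap R D (x o) * a + algebraMap R D (y o) * b
  have hcd : ∀ o i, p i ^ (k ⊓ l) i ∣ c o := fun o i =>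
    dvd_add
      (dvd_mul_of_dvd_right (by rw [ha, hp.pow_dvd_iff]; exact min_le_left _ _) _)
      (dvd_mul_of_dvd_right (by rw [hb, hp.pow_dvd_iff]; exact min_le_right _ _) _)
  have hab : ∀ i, p i ^ ((k ⊓ l) i + 1) ∣ a → p i ^ ((k ⊓ l) i + 1) ∣ b → False := by
    intro i h1 h2
    rw [ha, hp.pow_dvd_iff] at h1
    rw [hb, hp.pow_dvd_iff] at h2
    have : (k ⊓ l) i = min (k i) (l i) := rfl
    lia
  obtain ⟨o, ho⟩ : ∃ o, ∀ i, ¬ p i ^ ((k ⊓ l) i + 1) ∣ c o := by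
    by_contra! hbad
    choose f hf using hbad
    refine hcard f fun o o' hoo' => ?_
    have h1 := hf o
    have h2 := hf o'
    rw [← hoo'] at h2
    cases o with
    | none =>
      cases o' with
      | none => rfl
      | some t =>
        simp only [c, x, y, Option.elim, map_zero, map_one, zero_mul, one_mul, zero_add] at h1 h2
        exact (hab _ ((dvd_add_left (dvd_mul_of_dvd_right h1 _)).1 h2) h1).elim
    | some t =>
      cases o' with
      | none =>
        simp only [c, x, y, Option.elim, map_zero, map_one, zero_mul, one_mul, zero_add] at h1 h2
        exact (hab _ ((dvd_add_left (dvd_mul_of_dvd_right h2 _)).1 h1) h2).elim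
      | some t' =>
        simp only [c, x, y, Option.elim, map_one, one_mul] at h1 h2
        by_contra hne
        have h3 : p (f (some t)) ^ ((k ⊓ l) (f (some t)) + 1) ∣
            algebraMap R D (g t - g t') * b := by
          have := dvd_sub h1 h2
          rwa [add_sub_add_left_eq_sub, ← sub_mul, ← map_sub] at this
        have h4 : ¬ p (f (some t)) ∣ algebraMap R D (g t - g t') := by
          intro h
          have h5 := hR _ _ h
          rw [← IsLocalRing.residue_eq_zero_iff, map_sub, hg, hg, sub_eq_zero] at h5
          exact hne (congrArg some h5)
        have h6 := (hp.prime _).pow_dvd_of_dvd_mul_left _ h4 h3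
        exact hab _ ((dvd_add_left (dvd_mul_of_dvd_right h6 _)).1 h1) h6
  have hc0 : c o ≠ 0 := fun h0 => ho ⟨0, hs⟩ (h0 ▸ dvd_zero _)
  obtain ⟨w, hw⟩ := hp.exists_eq_of_pow_dvd hc0 (hcd o) ho
  exact ⟨x o, y o, w, hw⟩

end IsPrimeSystem

/-- Generators of the maximal ideals of a principal ideal domain that is not a field form a system
of representatives of the primes. -/
theorem exists_isPrimeSystem (D : Type*) [CommRing D] [IsDomain D] [IsPrincipalIdealRing D]
    [Finite (MaximalSpectrum D)] (hD : ¬ IsField D) :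
    ∃ p : Fin (Nat.card (MaximalSpectrum D)) → D, IsPrimeSystem p := by
  let e := (Finite.equivFin (MaximalSpectrum D)).symm
  let p := fun i => Submodule.IsPrincipal.generator (e i).asIdeal
  have hspan : ∀ i, Ideal.span {p i} = (e i).asIdeal := fun i =>
    Submodule.IsPrincipal.span_singleton_generator _
  have hprime : ∀ i, Prime (p i) := fun i =>
    Submodule.IsPrincipal.prime_generator_of_isPrime _
      (Ring.ne_bot_of_isMaximal_of_not_isField (e i).isMaximal hD)
  refine ⟨p, hprime, fun i j hij => ?_, fun q hq => ?_⟩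
  · apply e.injective
    ext1
    rw [← Ideal.span_singleton_le_span_singleton, hspan, hspan] at hij
    exact ((e j).isMaximal.eq_of_le (e i).isMaximal.ne_top hij).symm
  · have hmax : (Ideal.span {q}).IsMaximal :=
      PrincipalIdealRing.isMaximal_of_irreducible hq.irreducible
    refine ⟨e.symm ⟨_, hmax⟩, ?_⟩
    rw [← Ideal.span_singleton_le_span_singleton, hspan, Equiv.apply_symm_apply]

/-- A nonempty set of vectors in `ℕ ^ ι` that is closed under minima has a least element. -/
theorem exists_isLeast_of_inf_mem {ι : Type*} [Finite ι] {S : Set (ι → ℕ)} (hne : S.Nonempty)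
    (hinf : ∀ k ∈ S, ∀ l ∈ S, k ⊓ l ∈ S) : ∃ μ, IsLeast S μ := by
  obtain ⟨μ, hμ, hmin⟩ := WellFounded.has_min (wellFounded_lt (α := ι → ℕ)) S hne
  refine ⟨μ, hμ, fun k hk => ?_⟩
  have h := hmin _ (hinf μ hμ k hk)
  rw [← inf_eq_left]
  exact eq_of_le_of_not_lt inf_le_left h

end PrimeSystems

/-! ### Passage from `R̂` to the monoid `R^•` -/

section Transfer

variable {R K : Type*} [CommRing R] [Field K] [Algebra R K]

theorem mem_nonzeroMonoid {x : Kˣ} :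
    x ∈ nonzeroMonoid R K ↔ ∃ r : R, algebraMap R K r = x := Iff.rfl

theorem mem_unitGroup {G : Type*} [CommGroup G] {H : Submonoid G} {x : G} :
    x ∈ unitGroup H ↔ x ∈ H ∧ x⁻¹ ∈ H := Iff.rfl

variable [IsFractionRing R K]

theorem mem_unitGroup_nonzeroMonoid {x : Kˣ} {r : R} (h : algebraMap R K r = x) :
    x ∈ unitGroup (nonzeroMonoid R K) ↔ IsUnit r := by
  rw [mem_unitGroup, mem_nonzeroMonoid, mem_nonzeroMonoid]
  constructor
  · rintro ⟨-, t, ht⟩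
    refine IsUnit.of_mul_eq_one t (IsFractionRing.injective R K ?_)
    rw [map_mul, h, ht, map_one, Units.mul_inv]
  · rintro ⟨w, rfl⟩
    refine ⟨⟨_, h⟩, ((w⁻¹ : Rˣ) : R), ?_⟩
    rw [Units.val_inv_eq_inv_val, ← h, eq_comm]
    refine inv_eq_of_mul_eq_one_left ?_
    rw [← map_mul, Units.inv_mul, map_one]

variable [IsDomain R]

theorem mem_monoidCompleteIntegralClosure_iff {x : Kˣ} :
    x ∈ monoidCompleteIntegralClosure (nonzeroMonoid R K) ↔
      (x : K) ∈ completeIntegralClosure R K := by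
  constructor
  · rintro ⟨c, ⟨r, hr⟩, h⟩
    have hr0 : r ≠ 0 := by
      rintro rfl
      exact c.ne_zero (by rw [← hr, map_zero])
    refine ⟨r, mem_nonZeroDivisors_of_ne_zero hr0, fun n => ?_⟩
    obtain ⟨t, ht⟩ := h n
    exact ⟨t, by rw [ht, Algebra.smul_def, hr]; push_cast; rfl⟩
  · rintro ⟨r, hr, h⟩
    have hr0 : algebraMap R K r ≠ 0 := IsFractionRing.to_map_ne_zero_of_mem_nonZeroDivisors hr
    refine ⟨Units.mk0 _ hr0, ⟨r, rfl⟩, fun n => ?_⟩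
    obtain ⟨t, ht⟩ := h n
    exact ⟨t, by rw [ht, Algebra.smul_def]; push_cast; rfl⟩

theorem mem_unitGroup_monoidCompleteIntegralClosure_iff {x : Kˣ} :
    x ∈ unitGroup (monoidCompleteIntegralClosure (nonzeroMonoid R K)) ↔
      ∃ u : (completeIntegralClosure R K)ˣ, ((u : completeIntegralClosure R K) : K) = x := by
  rw [mem_unitGroup, mem_monoidCompleteIntegralClosure_iff, mem_monoidCompleteIntegralClosure_iff]
  constructor
  · rintro ⟨h, h'⟩
    exact ⟨⟨⟨x, h⟩, ⟨_, h'⟩, Subtype.ext (by simp), Subtype.ext (by simp)⟩, rfl⟩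
  · rintro ⟨u, hu⟩
    have hinv : ((x⁻¹ : Kˣ) : K) = ((u⁻¹ : (completeIntegralClosure R K)ˣ) :
        completeIntegralClosure R K) := by
      rw [Units.val_inv_eq_inv_val, ← hu]
      refine inv_eq_of_mul_eq_one_left ?_
      rw [← MulMemClass.coe_mul, Units.inv_mul, OneMemClass.coe_one]
    exact ⟨hu ▸ SetLike.coe_mem _, hinv ▸ SetLike.coe_mem _⟩

variable {s : ℕ} {p : Fin s → completeIntegralClosure R K} {P : Fin s → Kˣ}

theorem hasValues_iff (hP : ∀ i, (P i : K) = p i) {x : Kˣ} {k : Fin s → ℕ} :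
    HasValues (monoidCompleteIntegralClosure (nonzeroMonoid R K)) P x k ↔
      ∃ u : (completeIntegralClosure R K)ˣ,
        (x : K) = ((u * ∏ i, p i ^ k i : completeIntegralClosure R K) : K) := by
  have hval : ∀ (y : Kˣ) (u : (completeIntegralClosure R K)ˣ),
      ((u : completeIntegralClosure R K) : K) = y →
      ((u * ∏ i, p i ^ k i : completeIntegralClosure R K) : K) = (y * ∏ i, P i ^ k i : Kˣ) := by
    intro y u h
    push_cast
    simp only [h, hP]
  constructor
  · rintro ⟨y, hy, rfl⟩
    obtain ⟨u, hu⟩ := mem_unitGroup_monoidCompleteIntegralClosure_iff.1 hy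
    exact ⟨u, (hval y u hu).symm⟩
  · rintro ⟨u, hu⟩
    have hu0 : ((u : completeIntegralClosure R K) : K) ≠ 0 := by
      simp
    refine ⟨Units.mk0 _ hu0, mem_unitGroup_monoidCompleteIntegralClosure_iff.2 ⟨u, rfl⟩, ?_⟩
    exact Units.ext (hu.trans (hval _ u rfl))

variable [IsPrincipalIdealRing (completeIntegralClosure R K)]

theorem isFactorialWith (hp : IsPrimeSystem p) (hP : ∀ i, (P i : K) = p i) :
    IsFactorialWith (monoidCompleteIntegralClosure (nonzeroMonoid R K)) P where
  mem i := mem_monoidCompleteIntegralClosure_iff.2 (hP i ▸ SetLike.coe_mem _)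
  existsUnique_values a ha := by
    simp only [hasValues_iff hP]
    rw [mem_monoidCompleteIntegralClosure_iff] at ha
    have h0 : (⟨a, ha⟩ : completeIntegralClosure R K) ≠ 0 := fun h =>
      a.ne_zero (congrArg Subtype.val h)
    obtain ⟨u, k, h⟩ := hp.exists_values h0
    refine ⟨k, ⟨u, congrArg Subtype.val h⟩, ?_⟩
    rintro l ⟨w, hw⟩
    exact hp.values_unique (Subtype.ext (hw.symm.trans (congrArg Subtype.val h)))

end Transfer

/-! ### One-dimensional local domains -/

section OneDimensional

open Finset

variable {R K : Type*} [CommRing R] [Field K] [Algebra R K]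

/-- A nonzero conductor contains a nonzero `c ∈ R`, and every multiple of `c` in `R̂` lies
in `R`. -/
theorem exists_forall_dvd_mem_range (hcond : conductor R K ≠ ⊥) :
    ∃ c : R, c ≠ 0 ∧ ∀ d : completeIntegralClosure R K,
      algebraMap R (completeIntegralClosure R K) c ∣ d → ∃ r : R, algebraMap R K r = d := by
  obtain ⟨x, hx, hx0⟩ := Submodule.exists_mem_ne_zero_of_ne_bot hcond
  rw [conductor, Submodule.mem_div_iff_forall_mul_mem] at hx
  obtain ⟨c, hc⟩ := Submodule.mem_one.1 (hx 1 (one_mem (completeIntegralClosure R K)))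
  rw [mul_one] at hc
  refine ⟨c, ?_, ?_⟩
  · rintro rfl
    exact hx0 (by rw [← hc, map_zero])
  · rintro _ ⟨d, rfl⟩
    obtain ⟨r, hr⟩ := Submodule.mem_one.1 (hx d d.2)
    exact ⟨r, by rw [hr, ← hc]; rfl⟩

theorem not_isField_of_ringKrullDim_eq_one (hdim : ringKrullDim R = 1) : ¬ IsField R :=
  fun h => zero_ne_one ((ringKrullDim_eq_zero_of_isField h) ▸ hdim)

variable [IsDomain R]

theorem isMaximal_of_isPrime_of_ringKrullDim_eq_one (hdim : ringKrullDim R = 1) {I : Ideal R}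
    (hI : I ≠ ⊥) (hI' : I.IsPrime) : I.IsMaximal :=
  Ring.krullDimLE_one_iff_of_noZeroDivisors.mp (Ring.krullDimLE_iff.mpr (by simp [hdim])) I hI hI'

variable [IsFractionRing R K]

theorem not_isField_completeIntegralClosure (hdim : ringKrullDim R = 1)
    (hcond : conductor R K ≠ ⊥) : ¬ IsField (completeIntegralClosure R K) := by
  intro hfield
  obtain ⟨c, hc0, hc⟩ := exists_forall_dvd_mem_range hcond
  refine not_isField_of_ringKrullDim_eq_one hdim ⟨⟨0, 1, zero_ne_one⟩, mul_comm, fun {a} ha => ?_⟩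
  have hinj : ∀ {r : R}, r ≠ 0 → algebraMap R (completeIntegralClosure R K) r ≠ 0 := fun h =>
    (map_ne_zero_iff _ (FaithfulSMul.algebraMap_injective _ _)).2 h
  obtain ⟨b, hb⟩ := hfield.mul_inv_cancel (hinj ha)
  -- In a field, `c` divides everything, in particular the inverse `b` of `a`.
  obtain ⟨e, he⟩ := hfield.mul_inv_cancel (hinj hc0)
  obtain ⟨r, hr⟩ := hc b ⟨e * b, by rw [← mul_assoc, he, one_mul]⟩
  refine ⟨r, IsFractionRing.injective R K ?_⟩
  rw [map_mul, hr, map_one]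
  exact congrArg Subtype.val hb

variable [IsLocalRing R]

/-- Every prime element of `R̂` lies over the maximal ideal of `R`: the contraction of the prime
ideal that it generates contains a multiple in the conductor, hence is not zero. -/
theorem dvd_algebraMap_iff_mem_maximalIdeal (hdim : ringKrullDim R = 1)
    (hcond : conductor R K ≠ ⊥) {q : completeIntegralClosure R K} (hq : Prime q) (r : R) :
    q ∣ algebraMap R (completeIntegralClosure R K) r ↔ r ∈ IsLocalRing.maximalIdeal R := by
  obtain ⟨c, hc0, hc⟩ := exists_forall_dvd_mem_range hcond
  have hprime : (Ideal.span {q}).IsPrime := (Ideal.span_singleton_prime hq.ne_zero).2 hq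
  set I := (Ideal.span {q}).comap (algebraMap R (completeIntegralClosure R K)) with hI
  have hIbot : I ≠ ⊥ := by
    obtain ⟨t, ht⟩ := hc (algebraMap R _ c * q) (dvd_mul_right _ _)
    have ht' : algebraMap R (completeIntegralClosure R K) t = algebraMap R _ c * q :=
      Subtype.ext ht
    have hmem : t ∈ I := by
      rw [hI, Ideal.mem_comap, Ideal.mem_span_singleton, ht']
      exact dvd_mul_left _ _
    intro hbot
    rw [hbot, Ideal.mem_bot] at hmem
    rw [hmem, map_zero, eq_comm, mul_eq_zero, or_iff_left hq.ne_zero,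
      map_eq_zero_iff _ (FaithfulSMul.algebraMap_injective _ _)] at ht'
    exact hc0 ht'
  rw [← IsLocalRing.eq_maximalIdeal
    (isMaximal_of_isPrime_of_ringKrullDim_eq_one hdim hIbot inferInstance), hI, Ideal.mem_comap,
    Ideal.mem_span_singleton]

/-- If `R̂` is a semilocal principal ideal domain, then `R^•` is finitely primary of rank
`|max R̂|` with suitably chosen primes, and its value vectors have a smallest element as soon as
`|max R̂|` is at most the cardinality of the residue field of `R`. -/
theorem exists_isFinitelyPrimaryIn (hdim : ringKrullDim R = 1) (hcond : conductor R K ≠ ⊥)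
    [IsPrincipalIdealRing (completeIntegralClosure R K)]
    [Finite (MaximalSpectrum (completeIntegralClosure R K))] :
    ∃ (s α : ℕ) (P : Fin s → Kˣ),
      IsFinitelyPrimaryIn (nonzeroMonoid R K)
        (monoidCompleteIntegralClosure (nonzeroMonoid R K)) P α ∧
      IsSuitablyChosen (nonzeroMonoid R K)
        (monoidCompleteIntegralClosure (nonzeroMonoid R K)) P α ∧
      (Nonempty (MaximalSpectrum (completeIntegralClosure R K) ↪ IsLocalRing.ResidueField R) →
        ∃ μ, IsLeast (nonunitValues (nonzeroMonoid R K)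
          (monoidCompleteIntegralClosure (nonzeroMonoid R K)) P) μ) := by
  have hD := not_isField_completeIntegralClosure hdim hcond
  obtain ⟨c, hc0, hc⟩ := exists_forall_dvd_mem_range hcond
  have hc0' : algebraMap R (completeIntegralClosure R K) c ≠ 0 :=
    (map_ne_zero_iff _ (FaithfulSMul.algebraMap_injective _ _)).2 hc0
  obtain ⟨p₀, hp₀⟩ := exists_isPrimeSystem (completeIntegralClosure R K) hD
  have hs : 1 ≤ Nat.card (MaximalSpectrum (completeIntegralClosure R K)) :=
    Nat.card_pos
  obtain ⟨p, α, hp, hα, hcα, hcp⟩ := hp₀.exists_adapted hc0'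
  have hpm := fun i => dvd_algebraMap_iff_mem_maximalIdeal hdim hcond (hp.prime i)
  have hpK : ∀ i, (p i : K) ≠ 0 := fun i h => (hp.prime i).ne_zero (Subtype.ext h)
  let P : Fin _ → Kˣ := fun i => Units.mk0 (p i) (hpK i)
  have hP : ∀ i, (P i : K) = p i := fun i => rfl
  have hprod : ((∏ i, P i : Kˣ) : K) = ((∏ i, p i : completeIntegralClosure R K) : K) := by
    push_cast
    rfl
  have hle : nonzeroMonoid R K ≤ monoidCompleteIntegralClosure (nonzeroMonoid R K) := by
    rintro x ⟨r, hr⟩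
    rw [mem_monoidCompleteIntegralClosure_iff, ← hr]
    exact algebraMap_mem _ r
  refine ⟨_, α, P, ⟨hs, hα, isFactorialWith hp hP, hle, ?_, ?_⟩, ?_, ?_⟩
  · rintro a ⟨r, hr⟩ ha
    rw [mem_unitGroup_nonzeroMonoid hr, ← mem_nonunits_iff,
      ← IsLocalRing.mem_maximalIdeal] at ha
    obtain ⟨b, hb⟩ := hp.prod_dvd fun i => (hpm i r).2 ha
    have hb' : (a : K) = (∏ i, P i : Kˣ) * b := by
      rw [← hr, hprod]
      exact congrArg Subtype.val hb
    have hb0 : (b : K) ≠ 0 := fun h => a.ne_zero (by rw [hb', h, mul_zero])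
    exact ⟨Units.mk0 b hb0, mem_monoidCompleteIntegralClosure_iff.2 b.2, Units.ext hb'⟩
  · intro b hb
    rw [mem_monoidCompleteIntegralClosure_iff] at hb
    obtain ⟨r, hr⟩ := hc ((∏ i, p i) ^ α * ⟨b, hb⟩) (dvd_mul_of_dvd_left hcα _)
    refine ⟨r, ?_⟩
    rw [hr, Units.val_mul, Units.val_pow_eq_pow_val, hprod]
    rfl
  · intro i a _ k hk hαk
    obtain ⟨u, hu⟩ := (hasValues_iff hP).1 hk
    obtain ⟨r, hr⟩ := hc _ (hcp i _ ((hp.pow_dvd_iff u k i α).2 hαk))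
    have hr' : algebraMap R K r = p i * a - a := by
      rw [hr, MulMemClass.coe_mul, ← hu]
      push_cast
      ring
    rw [mem_nonzeroMonoid, mem_nonzeroMonoid, Units.val_mul, hP]
    constructor
    · rintro ⟨t, ht⟩
      exact ⟨t - r, by rw [map_sub, ht, hr']; ring⟩
    · rintro ⟨t, ht⟩
      exact ⟨t + r, by rw [map_add, ht, hr']; ring⟩
  · rintro ⟨g⟩
    have hcard : ∀ f : Option (IsLocalRing.ResidueField R) →
        Fin (Nat.card (MaximalSpectrum (completeIntegralClosure R K))),
        ¬ Function.Injective f := by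
      intro f hf
      have : Finite (Option (IsLocalRing.ResidueField R)) := Finite.of_injective f hf
      have : Finite (IsLocalRing.ResidueField R) :=
        Finite.of_injective _ (Option.some_injective _)
      have h1 := Nat.card_le_card_of_injective f hf
      have h2 := Nat.card_le_card_of_injective g g.injective
      rw [Finite.card_option, Nat.card_fin] at h1
      lia
    -- The value vectors of the non-units are those of the nonzero elements of the maximal ideal.
    have hmem : ∀ k, k ∈ nonunitValues (nonzeroMonoid R K)
        (monoidCompleteIntegralClosure (nonzeroMonoid R K)) P ↔
        ∃ r ∈ IsLocalRing.maximalIdeal R, ∃ u : (completeIntegralClosure R K)ˣ,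
          algebraMap R (completeIntegralClosure R K) r = u * ∏ i, p i ^ k i := by
      intro k
      constructor
      · rintro ⟨a, ⟨r, hr⟩, ha, hk⟩
        rw [mem_unitGroup_nonzeroMonoid hr, ← mem_nonunits_iff,
          ← IsLocalRing.mem_maximalIdeal] at ha
        obtain ⟨u, hu⟩ := (hasValues_iff hP).1 hk
        exact ⟨r, ha, u, Subtype.ext (hr.trans hu)⟩
      · rintro ⟨r, hr, u, hu⟩
        have hu0 : algebraMap R K r ≠ 0 := by
          have h1 : (u * ∏ i, p i ^ k i : completeIntegralClosure R K) ≠ 0 :=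
            mul_ne_zero u.ne_zero (prod_ne_zero_iff.2 fun i _ => pow_ne_zero _ (hp.prime i).ne_zero)
          rw [← hu] at h1
          exact fun h => h1 (Subtype.ext h)
        refine ⟨Units.mk0 _ hu0, ⟨r, rfl⟩, ?_, (hasValues_iff hP).2 ⟨u, congrArg Subtype.val hu⟩⟩
        rwa [mem_unitGroup_nonzeroMonoid (r := r) rfl, ← mem_nonunits_iff,
          ← IsLocalRing.mem_maximalIdeal]
    refine exists_isLeast_of_inf_mem ?_ fun k hk l hl => ?_
    · obtain ⟨r, hr, hr0⟩ := Submodule.exists_mem_ne_zero_of_ne_bot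
        ((IsLocalRing.isField_iff_maximalIdeal_eq.not).1 (not_isField_of_ringKrullDim_eq_one hdim))
      obtain ⟨u, k, hu⟩ := hp.exists_values
        ((map_ne_zero_iff _ (FaithfulSMul.algebraMap_injective R (completeIntegralClosure R K))).2
          hr0)
      exact ⟨k, (hmem k).2 ⟨r, hr, u, hu⟩⟩
    · obtain ⟨r, hr, u, hu⟩ := (hmem k).1 hk
      obtain ⟨t, ht, w, hw⟩ := (hmem l).1 hl
      obtain ⟨x, y, z, hz⟩ :=
        hp.exists_linearCombination_inf hs (fun i r => (hpm i r).1) hcard hu hw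
      exact (hmem _).2 ⟨x * r + y * t, add_mem (Ideal.mul_mem_left _ _ hr)
        (Ideal.mul_mem_left _ _ ht), z, by rw [← hz, map_add, map_mul, map_mul]⟩

end OneDimensional

/-! ### Noetherian domains -/

section Noetherian

variable {R K : Type*} [CommRing R] [Field K] [Algebra R K] [IsFractionRing R K]
  [IsNoetherianRing R]

/-- Multiplication by a nonzero element of the conductor embeds `R̂` into `R`. -/
theorem module_finite_completeIntegralClosure (hcond : conductor R K ≠ ⊥) :
    Module.Finite R (completeIntegralClosure R K) := by
  obtain ⟨c, hc0, hc⟩ := exists_forall_dvd_mem_range hcond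
  have hrange : ∀ d : completeIntegralClosure R K,
      algebraMap R K c * d ∈ LinearMap.range (Algebra.linearMap R K) := fun d =>
    hc (algebraMap R _ c * d) (dvd_mul_right _ _)
  let f : completeIntegralClosure R K →ₗ[R] LinearMap.range (Algebra.linearMap R K) :=
    (LinearMap.mulLeft R (algebraMap R K c) ∘ₗ
      (completeIntegralClosure R K).val.toLinearMap).codRestrict _ hrange
  refine Module.Finite.of_injective f fun x y hxy => Subtype.ext ?_
  exact mul_left_cancel₀ ((map_ne_zero_iff _ (IsFractionRing.injective R K)).2 hc0)
    (congrArg Subtype.val hxy)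

variable [IsDomain R]

theorem isIntegrallyClosed_completeIntegralClosure :
    IsIntegrallyClosed (completeIntegralClosure R K) := by
  rw [completeIntegralClosure_eq_integralClosure]
  exact integralClosure.isIntegrallyClosedOfFiniteExtension K

variable [IsLocalRing R]

theorem isDedekindDomain_completeIntegralClosure (hdim : ringKrullDim R = 1)
    (hcond : conductor R K ≠ ⊥) : IsDedekindDomain (completeIntegralClosure R K) := by
  have := module_finite_completeIntegralClosure hcond
  have : Ring.DimensionLEOne R := ⟨isMaximal_of_isPrime_of_ringKrullDim_eq_one hdim⟩
  have : IsIntegrallyClosed (completeIntegralClosure R K) :=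
    isIntegrallyClosed_completeIntegralClosure
  have : Ring.DimensionLEOne (completeIntegralClosure R K) := .of_isIntegral R _
  have : IsNoetherianRing (completeIntegralClosure R K) := IsNoetherianRing.of_finite R _
  exact {}

theorem finite_setOf_isMaximal (R S : Type*) [CommRing R] [IsLocalRing R] [CommRing S]
    [Algebra R S] [Module.Finite R S] : {I : Ideal S | I.IsMaximal}.Finite := by
  refine (Algebra.QuasiFinite.finite_primesOver (S := S)
    (IsLocalRing.maximalIdeal R)).subset fun I hI => ?_
  have : I.IsMaximal := hI
  exact ⟨hI.isPrime, ⟨(IsLocalRing.eq_maximalIdeal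
    (Ideal.isMaximal_comap_of_isIntegral_of_isMaximal I)).symm⟩⟩

theorem finite_quotient_map (S : Type*) {A : Type*} [CommRing A] [CommRing S] [Algebra A S]
    [Module.Finite A S] (I : Ideal A) [Finite (A ⧸ I)] : Finite (S ⧸ I.map (algebraMap A S)) :=
  have : Module.Finite (A ⧸ I) (S ⧸ I.map (algebraMap A S)) := .of_restrictScalars_finite A _ _
  Module.finite_of_finite (A ⧸ I)

/-- Units of `R̂` that are congruent modulo a nonzero element `c` of the conductor differ by a
unit of `R`, and `R̂ / c R̂` is finite. -/
theorem finiteUnitIndex_nonzeroMonoid (hdim : ringKrullDim R = 1) (hcond : conductor R K ≠ ⊥)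
    [Finite (IsLocalRing.ResidueField R)] : FiniteUnitIndex (nonzeroMonoid R K) := by
  have := module_finite_completeIntegralClosure hcond
  obtain ⟨c, hc0, hc⟩ := exists_forall_dvd_mem_range hcond
  have : Finite (R ⧸ Ideal.span {c}) := by
    rw [IsLocalRing.finite_quotient_iff]
    exact Ideal.exists_pow_le_of_le_radical_of_fg
      ((ringKrullDim_eq_one_iff_of_isLocalRing_isDomain.1 hdim).2 c hc0)
      (IsNoetherian.noetherian _)
  have : Finite (completeIntegralClosure R K ⧸
      Ideal.span {algebraMap R (completeIntegralClosure R K) c}) := by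
    have := finite_quotient_map (completeIntegralClosure R K) (Ideal.span {c})
    rwa [Ideal.map_span, Set.image_singleton] at this
  have hdiff : ∀ {x y : completeIntegralClosure R K},
      Ideal.Quotient.mk (Ideal.span {algebraMap R (completeIntegralClosure R K) c}) x =
        Ideal.Quotient.mk _ y → algebraMap R (completeIntegralClosure R K) c ∣ x - y := fun h =>
    Ideal.mem_span_singleton.1 (Ideal.Quotient.eq.1 h)
  have key : ∀ x y z : completeIntegralClosure R K, z * y = 1 →
      algebraMap R (completeIntegralClosure R K) c ∣ x - y →
      ∃ r : R, algebraMap R K r = (z * x : completeIntegralClosure R K) := by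
    intro x y z hzy hxy
    obtain ⟨r, hr⟩ := hc _ (dvd_mul_of_dvd_right hxy z)
    refine ⟨r + 1, ?_⟩
    rw [map_add, hr, map_one, mul_sub, hzy]
    push_cast
    ring
  choose g hg using fun x : unitGroup (monoidCompleteIntegralClosure (nonzeroMonoid R K)) =>
    mem_unitGroup_monoidCompleteIntegralClosure_iff.1 x.2
  have hginv : ∀ x : unitGroup (monoidCompleteIntegralClosure (nonzeroMonoid R K)),
      ((x : Kˣ) : K)⁻¹ = ((g x)⁻¹ : (completeIntegralClosure R K)ˣ) := by
    intro x
    rw [← hg]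
    refine inv_eq_of_mul_eq_one_left ?_
    rw [← MulMemClass.coe_mul, Units.inv_mul, OneMemClass.coe_one]
  refine Finite.of_injective (fun q => Ideal.Quotient.mk
    (Ideal.span {algebraMap R (completeIntegralClosure R K) c}) (g q.out)) fun q q' hqq' => ?_
  rw [← q.out_eq', ← q'.out_eq']
  refine QuotientGroup.eq.2 (Subgroup.mem_subgroupOf.2 ⟨?_, ?_⟩)
  · obtain ⟨r, hr⟩ := key _ _ _ (g q.out).inv_mul (hdiff hqq'.symm)
    exact ⟨r, by rw [hr]; push_cast; rw [hginv, hg]⟩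
  · obtain ⟨r, hr⟩ := key _ _ _ (g q'.out).inv_mul (hdiff hqq')
    exact ⟨r, by rw [hr]; push_cast; rw [mul_inv_rev, inv_inv, hginv, hg]⟩

end Noetherian

end RingLike

theorem corollary5p7 {R : Type u} {K : Type v} [CommRing R] [IsDomain R] [IsLocalRing R]
    [Field K] [Algebra R K] [IsFractionRing R K]
    (hdim : ringKrullDim R = 1)
    (hcond : RingLike.conductor R K ≠ ⊥) :
    ((IsPrincipalIdealRing (completeIntegralClosure R K) →
        Finite (MaximalSpectrum (completeIntegralClosure R K)) →
        Cardinal.lift.{u} (Cardinal.mk (MaximalSpectrum (completeIntegralClosure R K))) ≤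
          Cardinal.lift.{v} (Cardinal.mk (IsLocalRing.ResidueField R)) →
        RingLike.IsRingLike (RingLike.nonzeroMonoid R K)) ∧
      (IsNoetherianRing R → RingLike.IsRingLike (RingLike.nonzeroMonoid R K)) ∧
      (IsNoetherianRing R → Finite (IsLocalRing.ResidueField R) →
        Cardinal.lift.{u} (Cardinal.mk (MaximalSpectrum (completeIntegralClosure R K))) ≤
          Cardinal.lift.{v} (Cardinal.mk (IsLocalRing.ResidueField R)) →
        RingLike.IsStronglyRingLike (RingLike.nonzeroMonoid R K))) := by
  have hnoeth : IsNoetherianRing R → IsPrincipalIdealRing (completeIntegralClosure R K) ∧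
      Finite (MaximalSpectrum (completeIntegralClosure R K)) := by
    intro _
    have := RingLike.module_finite_completeIntegralClosure hcond
    have := RingLike.isDedekindDomain_completeIntegralClosure hdim hcond
    have hfin := RingLike.finite_setOf_isMaximal R (completeIntegralClosure R K)
    refine ⟨IsPrincipalIdealRing.of_finite_maximals hfin, ?_⟩
    have := hfin.to_subtype
    exact Finite.of_injective
      (fun I => (⟨I.asIdeal, I.isMaximal⟩ : {I : Ideal (completeIntegralClosure R K) |
        I.IsMaximal})) fun I J h => MaximalSpectrum.ext (congrArg Subtype.val h)
  refine ⟨fun _ _ hcard => ?_, fun hR => ?_, fun hR hk hcard => ?_⟩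
  · obtain ⟨s, α, P, h1, h2, h3⟩ := RingLike.exists_isFinitelyPrimaryIn hdim hcond
    exact ⟨s, α, P, h1, h2, Or.inr (h3 (Cardinal.lift_mk_le'.1 hcard))⟩
  · obtain ⟨_, _⟩ := hnoeth hR
    obtain ⟨s, α, P, h1, h2, h3⟩ := RingLike.exists_isFinitelyPrimaryIn hdim hcond
    refine ⟨s, α, P, h1, h2, ?_⟩
    -- If `|max R̂|` exceeds the cardinality of the residue field, then the latter is finite.
    rcases le_total (Cardinal.lift.{u} (Cardinal.mk (MaximalSpectrum
      (completeIntegralClosure R K))))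
      (Cardinal.lift.{v} (Cardinal.mk (IsLocalRing.ResidueField R))) with hcard | hcard
    · exact Or.inr (h3 (Cardinal.lift_mk_le'.1 hcard))
    · obtain ⟨g⟩ := Cardinal.lift_mk_le'.1 hcard
      have : Finite (IsLocalRing.ResidueField R) := Finite.of_injective g g.injective
      exact Or.inl (RingLike.finiteUnitIndex_nonzeroMonoid hdim hcond)
  · obtain ⟨_, _⟩ := hnoeth hR
    obtain ⟨s, α, P, h1, h2, h3⟩ := RingLike.exists_isFinitelyPrimaryIn hdim hcond
    exact ⟨s, α, P, h1, h2, RingLike.finiteUnitIndex_nonzeroMonoid hdim hcond,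
      h3 (Cardinal.lift_mk_le'.1 hcard)⟩
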